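/- All graphs are finite, simple and undirected. Let $n\ge 4$ be an integer and let $P_n$ be the path on $n$ vertices. Two edges of a graph $G$ are $P_n$-adjacent if they are distinct, share an endpoint, and lie in a common subgraph of $G$ isomorphic to $P_n$. The $P_n$-line graph $HL(G)$ has the edges of $G$ as its vertices, two of them being adjacent in $HL(G)$ exactly when they are $P_n$-adjacent in $G$. Put $HL^0(G)=G$ and $HL^{k+1}(G)=HL(HL^k(G))$ for $k\ge 0$. The sequence $\{HL^k(G)\}$ diverges by order if for every positive integer $N$ there is an integer $k\ge 0$ with $|V(HL^k(G))|\ge N$. For positive integers $x,y,z$, let $CL(x,y,z)$ be the graph of order $x+y+z+1$ that consists of three vertex-disjoint paths of orders $x,y,z$ and one further vertex, which is adjacent to exactly one end vertex of each of the three paths. Let $n \ge 4$, let $x,y,z$ be positive integers, and let $v$ be the vertex of degree $3$ in $CL(x,y,z)$. If the three edges incident to $v$ are pairwise $P_n$-adjacent in $CL(x,y,z)$, then the sequence $\{HL^k(CL(x,y,z))\}$ diverges by order. -/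

import Mathlib

universe u v

namespace HLine

/-- Two edges `e`, `f` of `G` are `H`-adjacent: they are adjacent edges (distinct, with a common
endpoint) and lie in a common subgraph of `G` isomorphic to `H`. -/
def HAdjacent {W : Type v} (H : SimpleGraph W) {V : Type u} (G : SimpleGraph V)
    (e f : G.edgeSet) : Prop :=
  G.lineGraph.Adj e f ∧
    ∃ K : G.Subgraph, Nonempty (K.coe ≃g H) ∧
      (e : Sym2 V) ∈ K.edgeSet ∧ (f : Sym2 V) ∈ K.edgeSet

/-- The `H`-line graph of `G`: its vertices are the edges of `G`, adjacent when `H`-adjacent. -/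
def HL {W : Type v} (H : SimpleGraph W) {V : Type u} (G : SimpleGraph V) :
    SimpleGraph G.edgeSet where
  Adj e f := HAdjacent H G e f
  symm := ⟨fun _ _ h => ⟨h.1.symm, h.2.imp fun _ hK => ⟨hK.1, hK.2.2, hK.2.1⟩⟩⟩
  loopless := ⟨fun _ h => h.1.ne rfl⟩

/-- The `k`-th iterate `HL^k(G)`, bundled with its vertex type; `HL^0(G) = G` and
`HL^(k+1)(G) = HL(HL^k(G))`. -/
def iterHL {W : Type v} (H : SimpleGraph W) {V : Type u} (G : SimpleGraph V) :
    ℕ → Σ U : Type u, SimpleGraph U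
  | 0 => ⟨V, G⟩
  | k + 1 => ⟨(iterHL H G k).2.edgeSet, HL H (iterHL H G k).2⟩

/-- The sequence `HL^k(G)` diverges by order: for every positive integer `N` some iterate has at
least `N` vertices. (For finite `G`, all the iterates are finite.) -/
def DivergesByOrder {W : Type v} (H : SimpleGraph W) {V : Type u} (G : SimpleGraph V) : Prop :=
  ∀ N : ℕ, 0 < N → ∃ k : ℕ, N ≤ Nat.card (iterHL H G k).1

/-- The spider `CL(x, y, z)`: the vertex `none`, and three disjoint paths (legs) of orders
`x`, `y`, `z`, with `some ⟨i, p⟩` the `p`-th vertex of the `i`-th leg. Consecutive vertices of a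
leg are adjacent, and `none` is adjacent to the first vertex of each leg. -/
def CL (x y z : ℕ) : SimpleGraph (Option (Σ i : Fin 3, Fin (![x, y, z] i))) :=
  SimpleGraph.fromRel fun a b =>
    match a, b with
    | none, some q => (q.2 : ℕ) = 0
    | some p, some q => p.1 = q.1 ∧ (p.2 : ℕ) + 1 = (q.2 : ℕ)
    | _, none => False

end HLine

/-! Call a graph good if each of its three-vertex paths extends to a path on at least `n` vertices
(`AllPaths`). In a good graph any two adjacent edges are `P_n`-adjacent, so `HL` is the ordinary
line graph (`AllPaths.HL_eq`).

Goodness passes to the line graph when the graph is connected and has a vertex with three neighbours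
(`AllPaths.lineGraph`). The edges of a long path form a path in the line graph with one vertex
fewer, and an edge off the path, inserted into the sequence, makes up the loss. Connectivity and
branching persist as well, so every iterate is an iterated line graph. By `card_edgeSet_lineGraph`,
size minus order grows by at least one per step; since the size of an iterate is the order of the
next, the orders are unbounded.

The spider is good (`allPaths_CL`): the hypothesis at the centre forces any two legs together with
the centre to have at least `n` vertices, and a three-vertex path centred elsewhere lies on such a
two-leg path. -/

namespace HLine

open SimpleGraph

/-! ### `P_n`-adjacency in terms of long paths through three vertices. -/

/-- The vertices `a`, `b`, `c` are consecutive on a path of `G` with at least `n` vertices. The path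
is described by its two branches at `b`. -/
def ThroughPath {V : Type*} (n : ℕ) (G : SimpleGraph V) (a b c : V) : Prop :=
  ∃ P Q : List V, (b :: a :: P).IsChain G.Adj ∧ (b :: c :: Q).IsChain G.Adj ∧
    (b :: (a :: P ++ c :: Q)).Nodup ∧ n ≤ P.length + Q.length + 3

theorem ThroughPath.symm {V : Type*} {n : ℕ} {G : SimpleGraph V} {a b c : V}
    (h : ThroughPath n G a b c) : ThroughPath n G c b a := by
  obtain ⟨P, Q, hP, hQ, hnd, hn⟩ := h
  refine ⟨Q, P, hQ, hP, ?_, by omega⟩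
  exact (List.Perm.cons b List.perm_append_comm).nodup_iff.1 hnd

/-- A chain without repetitions is a copy of a path graph. -/
def copyOfChain {V : Type*} {G : SimpleGraph V} (l : List V) (hl : l.IsChain G.Adj)
    (hnd : l.Nodup) : (pathGraph l.length).Copy G where
  toHom :=
    { toFun := fun i => l[i]
      map_rel' := by
        intro i j hij
        rw [pathGraph_adj] at hij
        rw [List.isChain_iff_getElem] at hl
        obtain ⟨i, hi⟩ := i
        obtain ⟨j, hj⟩ := j
        rcases hij with h | h
        · dsimp at h; subst h; exact hl i hj
        · dsimp at h; subst h; exact (hl j hi).symm }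
  injective' := by
    intro i j hij
    exact Fin.ext ((hnd.getElem_inj_iff).1 hij)

theorem ThroughPath.hAdjacent {V : Type*} {n : ℕ} (hn : 3 ≤ n) {G : SimpleGraph V} {a b c : V}
    (h : ThroughPath n G a b c) (hab : s(a, b) ∈ G.edgeSet) (hbc : s(b, c) ∈ G.edgeSet) :
    HAdjacent (pathGraph n) G ⟨s(a, b), hab⟩ ⟨s(b, c), hbc⟩ := by
  obtain ⟨P, Q, hP, hQ, hnd, hlen⟩ := h
  refine ⟨?_, ?_⟩
  · rw [lineGraph_adj_iff_exists]
    refine ⟨?_, b, by simp, by simp⟩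
    simp only [ne_eq, Subtype.mk.injEq, Sym2.eq_iff]
    simp at hnd
    grind
  -- The first branch keeps at most `n - 3` vertices beyond `a`, and the second gets what remains,
  -- possibly none by truncated subtraction; the total is exactly `n`.
  · set P' := P.take (n - 3) with hP'
    set Q' := Q.take (n - 3 - P.length) with hQ'
    have hl : ((a :: P').reverse ++ b :: c :: Q').length = n := by
      simp [hP', hQ']; omega
    have hc : ((a :: P').reverse ++ b :: c :: Q').IsChain G.Adj := by
      rw [List.isChain_append]
      have h1 : (b :: a :: P').IsChain G.Adj := by
        have := hP.take (n - 3 + 2); simpa using this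
      have h2 : (b :: c :: Q').IsChain G.Adj := by
        have := hQ.take (n - 3 - P.length + 2); simpa using this
      refine ⟨?_, h2, ?_⟩
      · rw [List.isChain_reverse]
        exact h1.tail.imp fun _ _ h => h.symm
      · simp
        exact (List.isChain_cons_cons.1 h1).1.symm
    have hnd' : ((a :: P').reverse ++ b :: c :: Q').Nodup := by
      have h1 : (b :: (a :: P' ++ c :: Q')).Nodup := by
        refine hnd.sublist (List.Sublist.cons_cons _ (List.Sublist.append ?_ ?_))
        · exact (List.take_sublist _ _).cons_cons _
        · exact (List.take_sublist _ _).cons_cons _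
      refine (List.Perm.nodup_iff ?_).1 h1
      refine List.perm_middle.symm.trans ?_
      exact List.Perm.append_right _ (List.reverse_perm _).symm
    generalize hL : (a :: P').reverse ++ b :: c :: Q' = l at *
    subst hl
    have e1 : l[P'.length]? = some a := by
      rw [← hL]; simp
    have e2 : l[P'.length + 1]? = some b := by
      rw [← hL]; simp
    have e3 : l[P'.length + 2]? = some c := by
      rw [← hL]; simp
    obtain ⟨k1, w1⟩ := List.getElem?_eq_some_iff.1 e1
    obtain ⟨k2, w2⟩ := List.getElem?_eq_some_iff.1 e2
    obtain ⟨k3, w3⟩ := List.getElem?_eq_some_iff.1 e3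
    refine ⟨(copyOfChain l hc hnd').toSubgraph, ⟨(copyOfChain l hc hnd').isoToSubgraph.symm⟩, ?_, ?_⟩
    · simp only [Subgraph.mem_edgeSet, Subgraph.map_adj, Relation.Map]
      exact ⟨⟨_, k1⟩, ⟨_, k2⟩, by simp [pathGraph_adj], w1, w2⟩
    · simp only [Subgraph.mem_edgeSet, Subgraph.map_adj, Relation.Map]
      exact ⟨⟨_, k2⟩, ⟨_, k3⟩, by simp [pathGraph_adj], w2, w3⟩

/-- A path that is given by a function on an initial segment of the natural numbers. -/
theorem ThroughPath.of_fun {V : Type*} {n N : ℕ} {G : SimpleGraph V} (f : ℕ → V)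
    (hf : ∀ i j, i < N → j < N → f i = f j → i = j) (hG : ∀ i, i + 1 < N → G.Adj (f i) (f (i + 1)))
    (hn : n ≤ N) {k : ℕ} (hk : k + 2 < N) : ThroughPath n G (f k) (f (k + 1)) (f (k + 2)) := by
  have hl : ∀ m, m < N → List.IsChain G.Adj (List.ofFn fun i : Fin (m + 1) => f (m - i)) := by
    intro m hm
    rw [List.isChain_ofFn]
    intro i hi
    have := (hG (m - i - 1) (by omega)).symm
    rwa [Nat.sub_add_cancel (by omega), Nat.sub_sub] at this
  have hr : List.IsChain G.Adj (List.ofFn fun i : Fin (N - k - 2 + 1) => f (k + 1 + i)) := by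
    rw [List.isChain_ofFn]
    intro i hi
    exact hG (k + 1 + i) (by omega)
  refine ⟨List.ofFn fun i : Fin k => f (k - 1 - i),
    List.ofFn fun i : Fin (N - k - 3) => f (k + 3 + i), ?_, ?_, ?_, by simp; omega⟩
  · convert hl (k + 1) (by omega) using 1
    rw [List.ofFn_succ, List.ofFn_succ]
    simp
    ext1
    congr 1
    omega
  · convert hr using 1
    rw [List.ofFn_succ]
    have : N - k - 2 = N - k - 3 + 1 := by omega
    rw [List.ofFn_congr this, List.ofFn_succ]
    simp
    ext1
    congr 1
    omega
  · have hnd : ∀ m (g : ℕ → ℕ), (∀ i < m, g i < N) → (∀ i < m, ∀ j < m, g i = g j → i = j) →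
        (List.ofFn fun i : Fin m => f (g i)).Nodup := by
      intro m g h1 h2
      rw [List.nodup_ofFn]
      intro i j hij
      exact Fin.ext (h2 i i.2 j j.2 (hf _ _ (h1 i i.2) (h1 j j.2) hij))
    have n1 := hnd k (fun i => k - 1 - i) (by intros; omega) (by intros; omega)
    have n2 := hnd (N - k - 3) (fun i => k + 3 + i) (by intros; omega) (by intros; omega)
    have key : ∀ i j, i < N → j < N → i ≠ j → f i ≠ f j := fun i j hi hj h h' => h (hf i j hi hj h')
    simp only [List.cons_append, List.nodup_cons, List.nodup_append, n1, n2, List.mem_cons,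
      List.mem_append, List.mem_ofFn, not_or, not_exists, true_and]
    refine ⟨⟨?_, ?_, ?_, ?_⟩, ⟨?_, ?_, ?_⟩, ⟨?_, trivial⟩, ?_⟩
    · exact key _ _ (by omega) (by omega) (by omega)
    · exact fun i => key _ _ (by omega) (by omega) (by omega)
    · exact key _ _ (by omega) (by omega) (by omega)
    · exact fun i => key _ _ (by omega) (by omega) (by omega)
    · exact fun i => key _ _ (by omega) (by omega) (by omega)
    · exact key _ _ (by omega) (by omega) (by omega)
    · exact fun i => key _ _ (by omega) (by omega) (by omega)
    · exact fun i => key _ _ (by omega) (by omega) (by omega)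
    · rintro _ ⟨i, rfl⟩ _ (rfl | ⟨j, rfl⟩)
      · exact key _ _ (by omega) (by omega) (by omega)
      · exact key _ _ (by omega) (by omega) (by omega)

theorem HAdjacent.throughPath {V : Type*} {n : ℕ} {G : SimpleGraph V} {a b c : V}
    (hab : s(a, b) ∈ G.edgeSet) (hbc : s(b, c) ∈ G.edgeSet)
    (h : HAdjacent (pathGraph n) G ⟨s(a, b), hab⟩ ⟨s(b, c), hbc⟩) : ThroughPath n G a b c := by
  obtain ⟨hadj, K, ⟨φ⟩, h1, h2⟩ := h
  have hac : a ≠ c := by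
    rintro rfl
    exact hadj.ne (Subtype.ext Sym2.eq_swap)
  rw [Subgraph.mem_edgeSet] at h1 h2
  have hn : 0 < n := (φ ⟨a, h1.fst_mem⟩).pos
  have : NeZero n := ⟨hn.ne'⟩
  let f : ℕ → V := fun i => φ.symm (Fin.ofNat n i)
  have hf : ∀ i j, i < n → j < n → f i = f j → i = j := by
    intro i j hi hj hij
    have := φ.symm.injective (Subtype.ext hij)
    simpa [Fin.ext_iff, Fin.ofNat, Nat.mod_eq_of_lt, hi, hj] using this
  have hG : ∀ i, i + 1 < n → G.Adj (f i) (f (i + 1)) := by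
    intro i hi
    refine K.adj_sub ?_
    rw [← Subgraph.coe_adj, φ.symm.map_adj_iff, pathGraph_adj]
    simp [Fin.ofNat, Nat.mod_eq_of_lt, hi, Nat.lt_of_succ_lt hi]
  have hv : ∀ v (hv : v ∈ K.verts), f (φ ⟨v, hv⟩) = v := by
    intro v hv
    simp [f]
  have ab : (pathGraph n).Adj (φ ⟨a, h1.fst_mem⟩) (φ ⟨b, h1.snd_mem⟩) := φ.map_adj_iff.2 h1
  have bc : (pathGraph n).Adj (φ ⟨b, h1.snd_mem⟩) (φ ⟨c, h2.snd_mem⟩) := φ.map_adj_iff.2 h2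
  rw [pathGraph_adj] at ab bc
  have va := hv a h1.fst_mem
  have vb := hv b h1.snd_mem
  have vc := hv c h2.snd_mem
  have la := (φ ⟨a, h1.fst_mem⟩).2
  have lc := (φ ⟨c, h2.snd_mem⟩).2
  generalize ((φ ⟨a, h1.fst_mem⟩ : Fin n) : ℕ) = i at *
  generalize ((φ ⟨b, h1.snd_mem⟩ : Fin n) : ℕ) = j at *
  generalize ((φ ⟨c, h2.snd_mem⟩ : Fin n) : ℕ) = k at *
  -- The positions of `a` and `c` are both at distance one from that of `b`; being distinct, they
  -- lie on opposite sides of it.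
  have hik : i ≠ k := by rintro rfl; exact hac (va.symm.trans vc)
  rcases ab with ab | ab <;> rcases bc with bc | bc
  · obtain rfl := ab
    obtain rfl := bc
    rw [← va, ← vb, ← vc]
    exact .of_fun f hf hG le_rfl lc
  · omega
  · omega
  · obtain rfl := bc
    obtain rfl := ab
    rw [← va, ← vb, ← vc]
    exact (ThroughPath.of_fun f hf hG le_rfl la).symm

/-! ### Edge sequences of paths. -/

/-- Two unordered pairs have a common element. -/
def Touch {V : Type*} (e f : Sym2 V) : Prop := ∃ v, v ∈ e ∧ v ∈ f

theorem Touch.symm {V : Type*} {e f : Sym2 V} (h : Touch e f) : Touch f e :=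
  let ⟨v, h1, h2⟩ := h; ⟨v, h2, h1⟩

/-- The list of edges traversed when walking from `b` through the vertices of a list. -/
def edgesFrom {V : Type*} : V → List V → List (Sym2 V)
  | _, [] => []
  | b, q :: Q => s(b, q) :: edgesFrom q Q

section edgesFrom

variable {V : Type*}

theorem length_edgesFrom (b : V) (Q : List V) : (edgesFrom b Q).length = Q.length := by
  induction Q generalizing b with
  | nil => rfl
  | cons q Q ih => simp [edgesFrom, ih]

theorem mem_of_mem_edgesFrom {b v : V} {Q : List V} {e : Sym2 V} (he : e ∈ edgesFrom b Q)
    (hv : v ∈ e) : v ∈ b :: Q := by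
  induction Q generalizing b with
  | nil => simp [edgesFrom] at he
  | cons q Q ih =>
    simp only [edgesFrom, List.mem_cons] at he
    rcases he with rfl | he
    · rw [Sym2.mem_iff] at hv; rcases hv with rfl | rfl <;> simp
    · exact List.mem_cons_of_mem _ (ih he)

theorem exists_mem_of_mem_edgesFrom {b : V} {Q : List V} {e : Sym2 V} (he : e ∈ edgesFrom b Q) :
    ∃ v ∈ e, v ∈ Q := by
  induction Q generalizing b with
  | nil => simp [edgesFrom] at he
  | cons q Q ih =>
    simp only [edgesFrom, List.mem_cons] at he
    rcases he with rfl | he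
    · exact ⟨q, by simp, by simp⟩
    · obtain ⟨v, h1, h2⟩ := ih he
      exact ⟨v, h1, List.mem_cons_of_mem _ h2⟩

theorem isChain_touch_edgesFrom {f : Sym2 V} {b : V} (hb : b ∈ f) (Q : List V) :
    (f :: edgesFrom b Q).IsChain Touch := by
  induction Q generalizing b f with
  | nil => simp [edgesFrom]
  | cons q Q ih =>
    rw [edgesFrom, List.isChain_cons_cons]
    exact ⟨⟨b, hb, by simp⟩, ih (by simp)⟩

theorem mem_edgeSet_of_mem_edgesFrom {G : SimpleGraph V} {b : V} {Q : List V}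
    (hQ : (b :: Q).IsChain G.Adj) {e : Sym2 V} (he : e ∈ edgesFrom b Q) : e ∈ G.edgeSet := by
  induction Q generalizing b with
  | nil => simp [edgesFrom] at he
  | cons q Q ih =>
    rw [List.isChain_cons_cons] at hQ
    simp only [edgesFrom, List.mem_cons] at he
    rcases he with rfl | he
    · exact hQ.1
    · exact ih hQ.2 he

theorem eq_of_mem_edgesFrom {b q : V} {Q : List V} (hnd : (b :: q :: Q).Nodup) {e : Sym2 V}
    (he : e ∈ edgesFrom b (q :: Q)) (hb : b ∈ e) : e = s(b, q) := by
  simp only [edgesFrom, List.mem_cons] at he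
  rcases he with he | he
  · exact he
  · exact absurd (mem_of_mem_edgesFrom he hb) (List.nodup_cons.1 hnd).1

theorem nodup_edgesFrom {b : V} {Q : List V} (hnd : (b :: Q).Nodup) : (edgesFrom b Q).Nodup := by
  induction Q generalizing b with
  | nil => simp [edgesFrom]
  | cons q Q ih =>
    have h := List.nodup_cons.1 hnd
    rw [edgesFrom, List.nodup_cons]
    exact ⟨fun he => h.1 (mem_of_mem_edgesFrom he (by simp)), ih h.2⟩

theorem nodup_edgesFrom_append {b : V} {P Q : List V} (hnd : (b :: (P ++ Q)).Nodup) :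
    (edgesFrom b P ++ edgesFrom b Q).Nodup := by
  rw [List.nodup_cons, List.nodup_append, List.mem_append, not_or] at hnd
  obtain ⟨⟨hP, hQ⟩, nP, nQ, hd⟩ := hnd
  rw [List.nodup_append]
  refine ⟨nodup_edgesFrom (List.nodup_cons.2 ⟨hP, nP⟩),
    nodup_edgesFrom (List.nodup_cons.2 ⟨hQ, nQ⟩), ?_⟩
  rintro e he _ he' rfl
  obtain ⟨v, hv, hvP⟩ := exists_mem_of_mem_edgesFrom he
  rcases List.mem_cons.1 (mem_of_mem_edgesFrom he' hv) with rfl | hvQ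
  · exact hP hvP
  · exact hd v hvP v hvQ rfl

/-- A path leaves its first vertex by one edge only and uses at most two edges at any later vertex.
-/
theorem not_three_mem_edgesFrom {b v : V} {Q : List V} (hnd : (b :: Q).Nodup) {e₁ e₂ e₃ : Sym2 V}
    (h₁ : e₁ ∈ edgesFrom b Q) (h₂ : e₂ ∈ edgesFrom b Q) (h₃ : e₃ ∈ edgesFrom b Q)
    (v₁ : v ∈ e₁) (v₂ : v ∈ e₂) (v₃ : v ∈ e₃) : e₁ = e₂ ∨ e₁ = e₃ ∨ e₂ = e₃ := by
  induction Q generalizing b with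
  | nil => simp [edgesFrom] at h₁
  | cons q Q ih =>
    by_cases hb : v = b
    · subst hb
      left
      rw [eq_of_mem_edgesFrom hnd h₁ v₁, eq_of_mem_edgesFrom hnd h₂ v₂]
    have hnd' := (List.nodup_cons.1 hnd).2
    have key : ∀ e : Sym2 V, v ∈ e → e ∈ edgesFrom b (q :: Q) →
        (e = s(b, q) ∧ v = q) ∨ e ∈ edgesFrom q Q := by
      intro e hv he
      simp only [edgesFrom, List.mem_cons] at he
      rcases he with rfl | he
      · rw [Sym2.mem_iff] at hv
        exact .inl ⟨rfl, hv.resolve_left hb⟩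
      · exact .inr he
    have k₁ := key _ v₁ h₁
    have k₂ := key _ v₂ h₂
    have k₃ := key _ v₃ h₃
    by_cases hq : v = q
    · subst hq
      cases Q with
      | nil =>
        simp only [edgesFrom, List.not_mem_nil, or_false] at k₁ k₂
        left
        rw [k₁.1, k₂.1]
      | cons r Q =>
        have key' : ∀ e : Sym2 V, v ∈ e → (e = s(b, v) ∧ v = v) ∨ e ∈ edgesFrom v (r :: Q) →
            e = s(b, v) ∨ e = s(v, r) := by
          rintro e hv (h | h)
          · exact .inl h.1
          · exact .inr (eq_of_mem_edgesFrom hnd' h hv)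
        have := key' _ v₁ k₁
        have := key' _ v₂ k₂
        have := key' _ v₃ k₃
        grind
    · exact ih hnd' (k₁.resolve_left fun h => hq h.2) (k₂.resolve_left fun h => hq h.2)
        (k₃.resolve_left fun h => hq h.2)

/-- The edge `h` goes directly after the edge that reaches `w`: the edges before and after it in the
sequence then contain `w`. -/
theorem exists_insert_edgesFrom {c d w : V} {Q : List V} {h : Sym2 V} (hw : w ∈ d :: Q)
    (hh : w ∈ h) : ∃ X, (s(c, d) :: X).IsChain Touch ∧ X.Perm (h :: edgesFrom d Q) := by
  induction Q generalizing c d with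
  | nil =>
    obtain rfl : w = d := by simpa using hw
    refine ⟨[h], ?_, by simp [edgesFrom]⟩
    simp only [List.isChain_cons_cons, List.isChain_singleton, and_true]
    exact ⟨w, by simp, hh⟩
  | cons q Q ih =>
    by_cases hd : w = d
    · subst hd
      refine ⟨h :: edgesFrom w (q :: Q), ?_, .refl _⟩
      rw [List.isChain_cons_cons]
      exact ⟨⟨w, by simp, hh⟩, isChain_touch_edgesFrom hh _⟩
    · obtain ⟨X, hX, hp⟩ := ih (c := d) (List.mem_of_ne_of_mem hd hw)
      refine ⟨s(d, q) :: X, ?_, ?_⟩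
      · rw [List.isChain_cons_cons]
        exact ⟨⟨d, by simp, by simp⟩, hX⟩
      · exact (hp.cons _).trans (List.Perm.swap _ _ _)

/-- If `g` is already an edge of the path, it is the first one, because it contains `c`; the chain
then continues with the remaining edges, which costs one unit of length. -/
theorem exists_touch_chain {c : V} {Q : List V} {g : Sym2 V} (hnd : (c :: Q).Nodup) (hc : c ∈ g) :
    ∃ X, (g :: X).IsChain Touch ∧ (g :: X).Nodup ∧ X ⊆ edgesFrom c Q ∧ Q.length ≤ X.length + 1 := by
  by_cases hg : g ∈ edgesFrom c Q
  · cases Q with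
    | nil => simp [edgesFrom] at hg
    | cons q Q =>
      obtain rfl := eq_of_mem_edgesFrom hnd hg hc
      exact ⟨edgesFrom q Q, isChain_touch_edgesFrom (by simp) Q, nodup_edgesFrom hnd,
        List.subset_cons_self _ _, by simp [length_edgesFrom]⟩
  · exact ⟨edgesFrom c Q, isChain_touch_edgesFrom hc Q,
      List.nodup_cons.2 ⟨hg, nodup_edgesFrom hnd⟩, List.Subset.refl _, by simp [length_edgesFrom]⟩

end edgesFrom

/-- `Touch` allows equal edges; the absence of repetitions supplies the distinctness needed for
adjacency. -/
theorem isChain_lineGraph {V : Type*} {G : SimpleGraph V} {l : List G.edgeSet}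
    (hl : (l.map Subtype.val).IsChain Touch) (hnd : l.Nodup) : l.IsChain G.lineGraph.Adj := by
  rw [List.isChain_map] at hl
  rw [List.isChain_iff_getElem] at hl ⊢
  intro i hi
  rw [lineGraph_adj_iff_exists]
  refine ⟨fun h => ?_, hl i hi⟩
  have := (hnd.getElem_inj_iff).1 h
  omega

theorem throughPath_lineGraph {V : Type*} {n : ℕ} {G : SimpleGraph V} {e f g : G.edgeSet}
    (P Q : List (Sym2 V)) (hP : (f.1 :: e.1 :: P).IsChain Touch)
    (hQ : (f.1 :: g.1 :: Q).IsChain Touch) (hnd : (f.1 :: (e.1 :: P ++ g.1 :: Q)).Nodup)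
    (hPG : ∀ h ∈ P, h ∈ G.edgeSet) (hQG : ∀ h ∈ Q, h ∈ G.edgeSet)
    (hn : n ≤ P.length + Q.length + 3) : ThroughPath n G.lineGraph e f g := by
  lift P to List G.edgeSet using hPG
  lift Q to List G.edgeSet using hQG
  have hnd' : (f :: (e :: P ++ g :: Q)).Nodup := by
    apply List.Nodup.of_map Subtype.val
    simpa using hnd
  refine ⟨P, Q, isChain_lineGraph (by simpa using hP) ?_, isChain_lineGraph (by simpa using hQ) ?_,
    hnd', by simpa using hn⟩
  · exact hnd'.sublist (List.Sublist.cons_cons _ (List.sublist_append_left _ _))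
  · exact hnd'.sublist (List.Sublist.cons_cons _ (List.sublist_append_right _ _))

/-! ### Goodness is inherited by the line graph. -/

/-- Every path on three vertices extends to a path on at least `n` vertices. -/
def AllPaths {V : Type*} (n : ℕ) (G : SimpleGraph V) : Prop :=
  ∀ a b c, G.Adj a b → G.Adj b c → a ≠ c → ThroughPath n G a b c

section step

variable {V : Type*} {n : ℕ} {G : SimpleGraph V}

/-- If `e = ua` and `g = uc`, then `f` contains `u` or closes the triangle as `ac`. Either way it is
off the long path through `a, u, c`, and inserting it between `e` and `g` restores the lost vertex.
-/
theorem AllPaths.lineGraph_of_touch (hG : AllPaths n G) {e f g : G.edgeSet} (hef : e ≠ f)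
    (hfg : f ≠ g) (heg : e ≠ g) (tef : Touch e.1 f.1) (tfg : Touch f.1 g.1) (teg : Touch e.1 g.1) :
    ThroughPath n G.lineGraph e f g := by
  obtain ⟨u, hue, hug⟩ := teg
  obtain ⟨e, he⟩ := e
  obtain ⟨f, hf⟩ := f
  obtain ⟨g, hg⟩ := g
  obtain ⟨a, rfl⟩ := Sym2.mem_iff_exists.1 hue
  obtain ⟨c, rfl⟩ := Sym2.mem_iff_exists.1 hug
  simp only [ne_eq, Subtype.mk.injEq] at hef hfg heg
  dsimp only at tef tfg
  have hac : a ≠ c := fun h => heg (by rw [h])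
  obtain ⟨P, Q, hP, hQ, hnd, hn⟩ := hG a u c he.symm hg hac
  have hndP : (u :: a :: P).Nodup :=
    hnd.sublist (List.Sublist.cons_cons _ (List.sublist_append_left _ _))
  have hndQ : (u :: c :: Q).Nodup :=
    hnd.sublist (List.Sublist.cons_cons _ (List.sublist_append_right _ _))
  have hf_eq : u ∈ f ∨ f = s(a, c) := by
    obtain ⟨p, hp, hp'⟩ := tef
    obtain ⟨q, hq, hq'⟩ := tfg
    by_cases hu : u ∈ f
    · exact .inl hu
    right
    rw [Sym2.mem_iff] at hp hq'
    have h1 : a ∈ f := by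
      rcases hp with rfl | rfl
      · exact absurd hp' hu
      · exact hp'
    have h2 : c ∈ f := by
      rcases hq' with rfl | rfl
      · exact absurd hq hu
      · exact hq
    exact (Sym2.mem_and_mem_iff hac).1 ⟨h1, h2⟩
  have hd : ∀ v ∈ a :: P, ∀ w ∈ c :: Q, v ≠ w := (List.nodup_append.1 (List.nodup_cons.1 hnd).2).2.2
  refine throughPath_lineGraph (edgesFrom a P) (edgesFrom c Q) ?_ ?_ ?_ ?_ ?_ ?_
  · exact List.isChain_cons_cons.2 ⟨tef.symm, isChain_touch_edgesFrom (by simp) P⟩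
  · exact List.isChain_cons_cons.2 ⟨tfg, isChain_touch_edgesFrom (by simp) Q⟩
  · change (f :: (edgesFrom u (a :: P) ++ edgesFrom u (c :: Q))).Nodup
    rw [List.nodup_cons, List.mem_append, not_or]
    refine ⟨⟨fun h => ?_, fun h => ?_⟩, nodup_edgesFrom_append hnd⟩
    · rcases hf_eq with hu | rfl
      · exact hef (eq_of_mem_edgesFrom hndP h hu).symm
      · rcases List.mem_cons.1 (mem_of_mem_edgesFrom h (Sym2.mem_mk_right a c)) with rfl | h
        · simp at hndQ
        · exact hd c h c (by simp) rfl
    · rcases hf_eq with hu | rfl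
      · exact hfg (eq_of_mem_edgesFrom hndQ h hu)
      · rcases List.mem_cons.1 (mem_of_mem_edgesFrom h (Sym2.mem_mk_left a c)) with rfl | h
        · simp at hndP
        · exact hd a (by simp) a h rfl
  · exact fun h hh => mem_edgeSet_of_mem_edgesFrom hP.tail hh
  · exact fun h hh => mem_edgeSet_of_mem_edgesFrom hQ.tail hh
  · simpa [length_edgesFrom] using hn

/-- The long path is taken through `h, b, c` rather than `a, b, c`. Then `ab` is off the path and is
inserted at `b`, between `bh` and `bc`; `cd` is either the next path edge or a further insertion. -/
theorem AllPaths.lineGraph_of_branch (hG : AllPaths n G) {a b c d h : V} (hab : s(a, b) ∈ G.edgeSet)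
    (hbc : s(b, c) ∈ G.edgeSet) (hcd : s(c, d) ∈ G.edgeSet) (hac : a ≠ c) (hbd : b ≠ d)
    (hhb : G.Adj h b) (hha : h ≠ a) (hhc : h ≠ c) :
    ThroughPath n G.lineGraph ⟨s(a, b), hab⟩ ⟨s(b, c), hbc⟩ ⟨s(c, d), hcd⟩ := by
  obtain ⟨P, Q, hP, hQ, hnd, hn⟩ := hG h b c hhb hbc hhc
  have hbc' : b ≠ c := G.ne_of_adj hbc
  have hndP : (b :: h :: P).Nodup :=
    hnd.sublist (List.Sublist.cons_cons _ (List.sublist_append_left _ _))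
  have hndQ : (b :: c :: Q).Nodup :=
    hnd.sublist (List.Sublist.cons_cons _ (List.sublist_append_right _ _))
  have hd : ∀ v ∈ h :: P, ∀ w ∈ c :: Q, v ≠ w := (List.nodup_append.1 (List.nodup_cons.1 hnd).2).2.2
  obtain ⟨X, hX, hXnd, hXs, hXl⟩ :=
    exists_touch_chain (List.nodup_cons.1 hndQ).2 (Sym2.mem_mk_left c d)
  refine throughPath_lineGraph (edgesFrom b (h :: P)) X ?_ ?_ ?_ ?_ ?_ ?_
  · exact List.isChain_cons_cons.2 ⟨⟨b, by simp, by simp⟩, isChain_touch_edgesFrom (by simp) _⟩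
  · exact List.isChain_cons_cons.2 ⟨⟨c, by simp, by simp⟩, hX⟩
  · have hall := nodup_edgesFrom_append hnd
    rw [List.nodup_append] at hall
    obtain ⟨ndP, ndQ, hdisj⟩ := hall
    have hmem : ∀ x ∈ X, x ∈ edgesFrom b (c :: Q) := fun x hx => List.mem_cons_of_mem _ (hXs hx)
    have f_notP : s(b, c) ∉ edgesFrom b (h :: P) := fun hx => hdisj _ hx _ List.mem_cons_self rfl
    have f_notX : s(b, c) ∉ X := fun hx => (List.nodup_cons.1 ndQ).1 (hXs hx)
    have e_notP : s(a, b) ∉ edgesFrom b (h :: P) := fun hx => by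
      have := eq_of_mem_edgesFrom hndP hx (by simp)
      rw [Sym2.eq_iff] at this
      grind
    have e_notX : s(a, b) ∉ X := fun hx => by
      have := eq_of_mem_edgesFrom hndQ (hmem _ hx) (by simp)
      rw [Sym2.eq_iff] at this
      grind
    have g_notP : s(c, d) ∉ edgesFrom b (h :: P) := fun hx => by
      rcases List.mem_cons.1 (mem_of_mem_edgesFrom hx (Sym2.mem_mk_left c d)) with rfl | h
      · exact hbc' rfl
      · exact hd c h c (by simp) rfl
    have hfe : s(b, c) ≠ s(a, b) := by rw [Ne, Sym2.eq_iff]; grind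
    have hfg : s(b, c) ≠ s(c, d) := by rw [Ne, Sym2.eq_iff]; grind
    have heg : s(a, b) ≠ s(c, d) := by rw [Ne, Sym2.eq_iff]; grind
    rw [List.nodup_cons, List.nodup_append, List.nodup_cons]
    refine ⟨?_, ⟨e_notP, ndP⟩, hXnd, ?_⟩
    · simp only [List.mem_append, List.mem_cons, not_or]
      exact ⟨⟨hfe, f_notP⟩, hfg, f_notX⟩
    · intro x hx y hy
      rw [List.mem_cons] at hx hy
      rcases hx with rfl | hx <;> rcases hy with rfl | hy
      · exact heg
      · rintro rfl; exact e_notX hy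
      · rintro rfl; exact g_notP hx
      · exact hdisj x hx y (hmem y hy)
  · exact fun x hx => mem_edgeSet_of_mem_edgesFrom hP hx
  · exact fun x hx => mem_edgeSet_of_mem_edgesFrom hQ.tail (hXs hx)
  · simp only [length_edgesFrom, List.length_cons]; omega

/-- Some vertex has three distinct neighbours. -/
def HasBranch {V : Type*} (G : SimpleGraph V) : Prop :=
  ∃ v a b c, G.Adj v a ∧ G.Adj v b ∧ G.Adj v c ∧ a ≠ b ∧ a ≠ c ∧ b ≠ c

/-- In a connected graph that is not a path or cycle, an edge outside a path meets the path. -/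
theorem exists_edge_notMem_path (hconn : G.Preconnected) (hbr : HasBranch G) {a b c : V}
    {P Q : List V} (hnd : (b :: (a :: P ++ c :: Q)).Nodup) :
    ∃ h ∈ G.edgeSet, (∃ w ∈ h, w ∈ b :: (a :: P ++ c :: Q)) ∧ h ∉ edgesFrom b (a :: P) ∧
      h ∉ edgesFrom b (c :: Q) := by
  obtain ⟨v, x, y, z, hx, hy, hz, hxy, hxz, hyz⟩ := hbr
  have hndP : (b :: a :: P).Nodup :=
    hnd.sublist (List.Sublist.cons_cons _ (List.sublist_append_left _ _))
  have hndQ : (b :: c :: Q).Nodup :=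
    hnd.sublist (List.Sublist.cons_cons _ (List.sublist_append_right _ _))
  have hd : ∀ v ∈ a :: P, ∀ w ∈ c :: Q, v ≠ w := (List.nodup_append.1 (List.nodup_cons.1 hnd).2).2.2
  by_cases hv : v ∈ b :: (a :: P ++ c :: Q)
  -- A path contains at most two of the edges at `v`, so one of the three given ones is off it.
  · by_contra! hcon
    have key : ∀ u, G.Adj v u → s(v, u) ∈ edgesFrom b (a :: P) ∨ s(v, u) ∈ edgesFrom b (c :: Q) := by
      intro u hu
      by_cases h : s(v, u) ∈ edgesFrom b (a :: P)
      · exact .inl h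
      · exact .inr (hcon _ hu ⟨v, by simp, hv⟩ h)
    have inj : ∀ {p q : V}, s(v, p) = s(v, q) → p = q := fun h => Sym2.congr_right.1 h
    have h3 : ∀ R : List V, (b :: R).Nodup → (∀ u, G.Adj v u → s(v, u) ∈ edgesFrom b R) → False := by
      intro R hR hall
      have := not_three_mem_edgesFrom (v := v) hR (hall x hx) (hall y hy) (hall z hz)
        (by simp) (by simp) (by simp)
      rcases this with h | h | h
      · exact hxy (inj h)
      · exact hxz (inj h)
      · exact hyz (inj h)
    rw [List.mem_cons, List.mem_append] at hv
    rcases hv with rfl | hv | hv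
    · have key' : ∀ u, G.Adj v u → u = a ∨ u = c := by
        intro u hu
        rcases key u hu with h | h
        · exact .inl (inj (eq_of_mem_edgesFrom hndP h (by simp)))
        · exact .inr (inj (eq_of_mem_edgesFrom hndQ h (by simp)))
      have := key' x hx
      have := key' y hy
      have := key' z hz
      grind
    · refine h3 _ hndP fun u hu => (key u hu).resolve_right fun h => ?_
      rcases List.mem_cons.1 (mem_of_mem_edgesFrom h (Sym2.mem_mk_left v u)) with rfl | h
      · exact (List.nodup_cons.1 hndP).1 hv
      · exact hd v hv v h rfl
    · refine h3 _ hndQ fun u hu => (key u hu).resolve_left fun h => ?_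
      rcases List.mem_cons.1 (mem_of_mem_edgesFrom h (Sym2.mem_mk_left v u)) with rfl | h
      · exact (List.nodup_cons.1 hndQ).1 hv
      · exact hd v h v hv rfl
  -- A walk from `v` to the path has a dart entering the path; its first endpoint is off the path,
  -- so its edge is not a path edge.
  · obtain ⟨p⟩ := hconn v b
    obtain ⟨d, -, hd1, hd2⟩ :=
      p.exists_boundary_dart {u | u ∉ b :: (a :: P ++ c :: Q)} hv (by simp)
    simp only [Set.mem_ofPred_eq, not_not] at hd1 hd2
    refine ⟨d.edge, d.edge_mem, ⟨d.snd, Sym2.mem_mk_right _ _, hd2⟩, fun h => ?_, fun h => ?_⟩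
    · have := mem_of_mem_edgesFrom h (Sym2.mem_mk_left d.fst d.snd)
      apply hd1
      rw [← List.cons_append]
      exact List.mem_append_left _ this
    · have := mem_of_mem_edgesFrom h (Sym2.mem_mk_left d.fst d.snd)
      apply hd1
      rw [List.mem_cons] at this ⊢
      exact this.imp_right fun h => List.mem_append_right _ h

/-- If the long path through `a, b, c` ends at `c`, then `cd` is the extra edge. Otherwise the path
continues to `d`, and the extra edge comes from `exists_edge_notMem_path`. -/
theorem AllPaths.lineGraph_of_no_branch (hG : AllPaths n G) (hconn : G.Preconnected)
    (hbr : HasBranch G) {a b c d : V} (hab : s(a, b) ∈ G.edgeSet)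
    (hbc : s(b, c) ∈ G.edgeSet) (hcd : s(c, d) ∈ G.edgeSet) (hac : a ≠ c) (hbd : b ≠ d)
    (hb : ∀ u, G.Adj b u → u = a ∨ u = c) (hc : ∀ u, G.Adj c u → u = b ∨ u = d) :
    ThroughPath n G.lineGraph ⟨s(a, b), hab⟩ ⟨s(b, c), hbc⟩ ⟨s(c, d), hcd⟩ := by
  obtain ⟨P, Q, hP, hQ, hnd, hn⟩ := hG a b c hab hbc hac
  have hbc' : b ≠ c := G.ne_of_adj hbc
  have hndP : (b :: a :: P).Nodup :=
    hnd.sublist (List.Sublist.cons_cons _ (List.sublist_append_left _ _))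
  have hndQ : (b :: c :: Q).Nodup :=
    hnd.sublist (List.Sublist.cons_cons _ (List.sublist_append_right _ _))
  have hd : ∀ v ∈ a :: P, ∀ w ∈ c :: Q, v ≠ w := (List.nodup_append.1 (List.nodup_cons.1 hnd).2).2.2
  have hba : s(a, b) = s(b, a) := Sym2.eq_swap
  have hall := nodup_edgesFrom_append hnd
  have hperm := (List.perm_middle (a := s(b, c)) (l₁ := edgesFrom b (a :: P))
    (l₂ := edgesFrom c Q)).nodup_iff.1 hall
  have cP : ((s(b, c) :: s(a, b) :: edgesFrom a P)).IsChain Touch :=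
    List.isChain_cons_cons.2 ⟨⟨b, by simp, by simp⟩, isChain_touch_edgesFrom (by simp) _⟩
  cases Q with
  | nil =>
    refine throughPath_lineGraph (edgesFrom a P) [] cP ?_ ?_ ?_ ?_ ?_
    · simp only [List.isChain_cons_cons, List.isChain_singleton, and_true]
      exact ⟨c, by simp, by simp⟩
    · have hg : s(c, d) ∉ s(b, c) :: edgesFrom b (a :: P) := by
        rw [List.mem_cons, not_or, Sym2.eq_iff]
        refine ⟨by grind, fun h => ?_⟩
        rcases List.mem_cons.1 (mem_of_mem_edgesFrom h (Sym2.mem_mk_left c d)) with rfl | h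
        · exact hbc' rfl
        · exact hd c h c (by simp) rfl
      have := List.nodup_cons.2 ⟨hg, by simpa [edgesFrom] using hperm⟩
      refine (List.Perm.nodup_iff ?_).1 this
      dsimp only; rw [hba]
      exact List.perm_append_comm (l₁ := [s(c, d)])
    · exact fun x hx => mem_edgeSet_of_mem_edgesFrom hP.tail hx
    · simp
    · simpa [length_edgesFrom] using hn
  | cons d' Q =>
    have hd'Q := List.isChain_cons_cons.1 hQ.tail
    obtain rfl : d' = d := by
      refine (hc d' hd'Q.1).resolve_left ?_
      rintro rfl
      simp at hndQ
    obtain ⟨h, hhG, ⟨w, hwh, hw⟩, hhP, hhQ⟩ := exists_edge_notMem_path hconn hbr hnd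
    -- All edges at `b` and `c` are on the path, so `h` attaches elsewhere and its insertion keeps
    -- the three given edges consecutive.
    have hw' : w ∈ a :: P ∨ w ∈ d' :: Q := by
      obtain ⟨u, rfl⟩ := Sym2.mem_iff_exists.1 hwh
      simp only [edgesFrom, List.mem_cons, not_or] at hhP hhQ
      rw [List.mem_cons, List.mem_append, List.mem_cons (l := d' :: Q)] at hw
      rcases hw with rfl | hw | rfl | hw
      · rcases hb u hhG with rfl | rfl
        · exact absurd rfl hhP.1
        · exact absurd rfl hhQ.1
      · exact .inl hw
      · rcases hc u hhG with rfl | rfl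
        · exact absurd Sym2.eq_swap hhQ.1
        · exact absurd rfl hhQ.2.1
      · exact .inr hw
    have hfull : (h :: (edgesFrom b (a :: P) ++ edgesFrom b (c :: d' :: Q))).Nodup := by
      rw [List.nodup_cons, List.mem_append, not_or]
      exact ⟨⟨hhP, hhQ⟩, hall⟩
    have PG : ∀ x ∈ edgesFrom a P, x ∈ G.edgeSet :=
      fun x hx => mem_edgeSet_of_mem_edgesFrom hP.tail hx
    have QG : ∀ x ∈ edgesFrom d' Q, x ∈ G.edgeSet :=
      fun x hx => mem_edgeSet_of_mem_edgesFrom hd'Q.2 hx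
    rcases hw' with hw | hw
    · obtain ⟨X, hX, hp⟩ := exists_insert_edgesFrom (c := b) hw hwh
      refine throughPath_lineGraph X (edgesFrom d' Q) ?_ ?_ ?_ ?_ QG ?_
      · dsimp only; rw [hba]
        exact List.isChain_cons_cons.2 ⟨⟨b, by simp, by simp⟩, hX⟩
      · exact List.isChain_cons_cons.2 ⟨⟨c, by simp, by simp⟩, isChain_touch_edgesFrom (by simp) _⟩
      · dsimp only; rw [hba]
        refine (List.Perm.nodup_iff ?_).2 hfull
        simp only [edgesFrom, List.cons_append]
        refine ((((hp.append_right _).cons s(b, a)).cons s(b, c))).trans ?_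
        simp only [← Multiset.coe_eq_coe, ← Multiset.cons_coe, ← Multiset.coe_add,
          ← Multiset.singleton_add]
        abel
      · intro x hx
        rcases List.mem_cons.1 (hp.subset hx) with rfl | hx
        · exact hhG
        · exact PG x hx
      · have := hp.length_eq
        simp only [List.length_cons, length_edgesFrom] at this hn ⊢
        omega
    · obtain ⟨X, hX, hp⟩ := exists_insert_edgesFrom (c := c) hw hwh
      refine throughPath_lineGraph (edgesFrom a P) X cP ?_ ?_ PG ?_ ?_
      · exact List.isChain_cons_cons.2 ⟨⟨c, by simp, by simp⟩, hX⟩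
      · dsimp only; rw [hba]
        refine (List.Perm.nodup_iff ?_).2 hfull
        simp only [edgesFrom, List.cons_append]
        refine (((((hp.cons s(c, d')).append_left _).cons s(b, a)).cons s(b, c))).trans ?_
        simp only [← Multiset.coe_eq_coe, ← Multiset.cons_coe, ← Multiset.coe_add,
          ← Multiset.singleton_add]
        abel
      · intro x hx
        rcases List.mem_cons.1 (hp.subset hx) with rfl | hx
        · exact hhG
        · exact QG x hx
      · have := hp.length_eq
        simp only [List.length_cons, length_edgesFrom] at this hn ⊢
        omega

theorem AllPaths.lineGraph (hG : AllPaths n G) (hconn : G.Preconnected) (hbr : HasBranch G) :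
    AllPaths n G.lineGraph := by
  intro e f g hef hfg heg
  rw [lineGraph_adj_iff_exists] at hef hfg
  obtain ⟨hef, tef⟩ := hef
  obtain ⟨hfg, tfg⟩ := hfg
  by_cases teg : Touch e.1 g.1
  · exact hG.lineGraph_of_touch hef hfg heg tef tfg teg
  obtain ⟨b, hbe, hbf⟩ := tef
  obtain ⟨c, hcf, hcg⟩ := tfg
  obtain ⟨e, he⟩ := e
  obtain ⟨f, hf⟩ := f
  obtain ⟨g, hg⟩ := g
  dsimp only at teg hbe hbf hcf hcg
  have hbc : b ≠ c := by
    rintro rfl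
    exact teg ⟨b, hbe, hcg⟩
  obtain rfl := (Sym2.mem_and_mem_iff hbc).1 ⟨hbf, hcf⟩
  obtain ⟨a, hae⟩ := Sym2.mem_iff_exists.1 hbe
  obtain rfl := hae.trans Sym2.eq_swap
  obtain ⟨d, rfl⟩ := Sym2.mem_iff_exists.1 hcg
  have hac : a ≠ c := by
    rintro rfl
    exact teg ⟨a, by simp, by simp⟩
  have hbd : b ≠ d := by
    rintro rfl
    exact teg ⟨b, by simp, by simp⟩
  by_cases hb : ∀ u, G.Adj b u → u = a ∨ u = c
  · by_cases hc : ∀ u, G.Adj c u → u = b ∨ u = d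
    · exact hG.lineGraph_of_no_branch hconn hbr he hf hg hac hbd hb hc
    · push Not at hc
      obtain ⟨h, hh, hhb, hhd⟩ := hc
      have he' : s(b, a) ∈ G.edgeSet := he.symm
      have hf' : s(c, b) ∈ G.edgeSet := hf.symm
      have hg' : s(d, c) ∈ G.edgeSet := hg.symm
      have := (hG.lineGraph_of_branch hg' hf' he' hbd.symm hac.symm hh.symm hhd hhb).symm
      convert this using 2 <;> exact Sym2.eq_swap
  · push Not at hb
    obtain ⟨h, hh, hha, hhc⟩ := hb
    exact hG.lineGraph_of_branch he hf hg hac hbd hh.symm hha hhc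

end step

/-! ### Connectivity and branching of the line graph. -/

theorem reachable_lineGraph {V : Type*} {G : SimpleGraph V} {u v : V} (p : G.Walk u v)
    {e f : G.edgeSet} (he : u ∈ e.1) (hf : v ∈ f.1) : G.lineGraph.Reachable e f := by
  have touch : ∀ {w : V} {e f : G.edgeSet}, w ∈ e.1 → w ∈ f.1 → G.lineGraph.Reachable e f := by
    intro w e f he hf
    by_cases h : e = f
    · rw [h]
    · exact (lineGraph_adj_iff_exists.2 ⟨h, w, he, hf⟩).reachable
  induction p generalizing e with
  | nil => exact touch he hf
  | @cons a b c h p ih =>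
    exact (touch (f := ⟨s(a, b), h⟩) he (Sym2.mem_mk_left a b)).trans
      (ih (Sym2.mem_mk_right a b) hf)

theorem preconnected_lineGraph {V : Type*} {G : SimpleGraph V} (hG : G.Preconnected) :
    G.lineGraph.Preconnected := by
  intro e f
  obtain ⟨p⟩ := hG e.1.out.1 f.1.out.1
  exact reachable_lineGraph p (Sym2.out_fst_mem _) (Sym2.out_fst_mem _)

theorem hasBranch_lineGraph_of_adj {V : Type*} {G : SimpleGraph V} {v a b c w : V}
    (ha : G.Adj v a) (hb : G.Adj v b) (hc : G.Adj v c) (hab : a ≠ b) (hac : a ≠ c) (hbc : b ≠ c)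
    (haw : G.Adj a w) (hwv : w ≠ v) : HasBranch G.lineGraph := by
  have hva := G.ne_of_adj ha
  refine ⟨⟨s(v, a), ha⟩, ⟨s(v, b), hb⟩, ⟨s(v, c), hc⟩, ⟨s(a, w), haw⟩, ?_, ?_, ?_, ?_, ?_, ?_⟩
  · exact lineGraph_adj_iff_exists.2 ⟨by simp; grind, v, by simp, by simp⟩
  · exact lineGraph_adj_iff_exists.2 ⟨by simp; grind, v, by simp, by simp⟩
  · exact lineGraph_adj_iff_exists.2 ⟨by simp; grind, a, by simp, by simp⟩
  all_goals simp; grind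

/-- As `n ≥ 4`, the path through `a, v, b` has a fourth vertex, so `va` or `vb` meets an edge away
from `v` besides the other two at `v`. For `n = 3` the claw, whose line graph is a triangle, is an
exception. -/
theorem AllPaths.hasBranch_lineGraph {V : Type*} {G : SimpleGraph V} {n : ℕ} (hG : AllPaths n G)
    (hn : 4 ≤ n) (hbr : HasBranch G) : HasBranch G.lineGraph := by
  obtain ⟨v, a, b, c, ha, hb, hc, hab, hac, hbc⟩ := hbr
  obtain ⟨P, Q, hP, hQ, hnd, hlen⟩ := hG a v b ha.symm hb hab
  cases P with
  | cons w P =>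
    refine hasBranch_lineGraph_of_adj ha hb hc hab hac hbc
      (List.isChain_cons_cons.1 hP.tail).1 (w := w) ?_
    rintro rfl
    simp at hnd
  | nil =>
    cases Q with
    | cons w Q =>
      refine hasBranch_lineGraph_of_adj hb ha hc hab.symm hbc hac
        (List.isChain_cons_cons.1 hQ.tail).1 (w := w) ?_
      rintro rfl
      simp at hnd
    | nil => simp at hlen; omega

/-! ### Counting edges of the line graph. -/

theorem sum_degree_mul_le {V : Type*} [Fintype V] [DecidableEq V] (G : SimpleGraph V)
    [DecidableRel G.Adj] [DecidableRel G.lineGraph.Adj] :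
    ∑ v, (G.degree v * G.degree v - G.degree v) ≤ 2 * G.lineGraph.edgeFinset.card := by
  have hadj : ∀ (v : V) (p : (G.neighborFinset v).offDiag), G.Adj v p.1.1 ∧ G.Adj v p.1.2 ∧
      p.1.1 ≠ p.1.2 := by
    rintro v ⟨p, hp⟩
    simpa [Finset.mem_offDiag] using hp
  let F : (Σ v : V, (G.neighborFinset v).offDiag) → G.lineGraph.Dart := fun x =>
    { fst := ⟨s(x.1, x.2.1.1), (hadj x.1 x.2).1⟩
      snd := ⟨s(x.1, x.2.1.2), (hadj x.1 x.2).2.1⟩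
      adj := lineGraph_adj_iff_exists.2 ⟨fun h => (hadj x.1 x.2).2.2
        (Sym2.congr_right.1 (congrArg Subtype.val h)), x.1, by simp, by simp⟩ }
  have hF : Function.Injective F := by
    rintro ⟨v, ⟨⟨a, b⟩, h⟩⟩ ⟨v', ⟨⟨a', b'⟩, h'⟩⟩ heq
    have h1 := congrArg (fun d : G.lineGraph.Dart => d.fst.1) heq
    have h2 := congrArg (fun d : G.lineGraph.Dart => d.snd.1) heq
    have h3 := (hadj v ⟨_, h⟩).2.2
    have h4 := (hadj v' ⟨_, h'⟩).2.2
    simp only [F, Sym2.eq_iff] at h1 h2 h3 h4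
    -- Distinct edges share at most one vertex, so the pair of edges determines `v`.
    obtain rfl : v = v' := by grind
    obtain rfl : a = a' := by grind
    obtain rfl : b = b' := by grind
    rfl
  have := Fintype.card_le_of_injective F hF
  rw [G.lineGraph.dart_card_eq_twice_card_edges, Fintype.card_sigma] at this
  simpa only [Fintype.card_coe, Finset.offDiag_card, card_neighborFinset_eq_degree] using this

/-- The difference between size and order strictly grows when passing to the line graph. -/
theorem card_edgeSet_lineGraph {V : Type*} [Finite V] {G : SimpleGraph V} (hbr : HasBranch G) :
    2 * Nat.card G.edgeSet + 1 ≤ Nat.card G.lineGraph.edgeSet + Nat.card V := by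
  classical
  have := Fintype.ofFinite V
  have h1 := sum_degree_mul_le G
  have h2 := G.sum_degrees_eq_twice_card_edges
  obtain ⟨v, a, b, c, ha, hb, hc, hab, hac, hbc⟩ := hbr
  have hdeg : 3 ≤ G.degree v := by
    have hs : ({a, b, c} : Finset V) ⊆ G.neighborFinset v := by
      intro x hx
      simp only [Finset.mem_insert, Finset.mem_singleton] at hx
      rw [mem_neighborFinset]
      rcases hx with rfl | rfl | rfl <;> assumption
    have := Finset.card_le_card hs
    rwa [Finset.card_eq_three.2 ⟨a, b, c, hab, hac, hbc, rfl⟩] at this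
  -- This is `(d - 1)(d - 2) ≥ 0`, with value at least 2 when `d ≥ 3`. That 2 at `v` becomes the
  -- final `+ 1` after halving.
  have hpt : ∀ u, 3 * G.degree u + (if u = v then 2 else 0) ≤
      (G.degree u * G.degree u - G.degree u) + 2 + G.degree u := by
    intro u
    have hle : G.degree u ≤ G.degree u * G.degree u := Nat.le_mul_self _
    split_ifs with h
    · rw [h] at hle ⊢
      have := Nat.mul_le_mul_right (G.degree v) hdeg
      omega
    · by_cases h3 : 3 ≤ G.degree u
      · have := Nat.mul_le_mul_right (G.degree u) h3
        omega
      · have : G.degree u < 3 := by omega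
        interval_cases G.degree u <;> omega
  have hsum := Finset.sum_le_sum fun u (_ : u ∈ Finset.univ) => hpt u
  simp only [Finset.sum_add_distrib, ← Finset.mul_sum, Finset.sum_ite_eq', Finset.mem_univ,
    if_true, Finset.sum_const, Finset.card_univ, smul_eq_mul, h2] at hsum
  have e1 : Nat.card G.edgeSet = G.edgeFinset.card := by
    rw [Nat.card_eq_fintype_card, edgeFinset_card]
  have e2 : Nat.card G.lineGraph.edgeSet = G.lineGraph.edgeFinset.card := by
    rw [Nat.card_eq_fintype_card, edgeFinset_card]
  rw [e1, e2, Nat.card_eq_fintype_card]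
  omega

/-! ### Iteration and divergence. -/

theorem AllPaths.HL_eq {V : Type*} {G : SimpleGraph V} {n : ℕ} (hG : AllPaths n G) (hn : 3 ≤ n) :
    HL (pathGraph n) G = G.lineGraph := by
  ext e f
  refine ⟨fun h => h.1, fun h => ?_⟩
  obtain ⟨hne, b, hbe, hbf⟩ := lineGraph_adj_iff_exists.1 h
  obtain ⟨e, he⟩ := e
  obtain ⟨f, hf⟩ := f
  obtain ⟨a, hae⟩ := Sym2.mem_iff_exists.1 hbe
  obtain rfl : e = s(a, b) := hae.trans Sym2.eq_swap
  obtain ⟨c, rfl⟩ := Sym2.mem_iff_exists.1 hbf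
  refine (hG a b c he hf ?_).hAdjacent hn he hf
  rintro rfl
  exact hne (Subtype.ext Sym2.eq_swap)

/-- The last clause says that size minus order of the `k`-th iterate is at least `k - |V|`; it adds
up the gains of one per step. -/
theorem AllPaths.iterHL_invariant {V : Type*} [Finite V] {G : SimpleGraph V} {n : ℕ}
    (hG : AllPaths n G) (hn : 4 ≤ n) (hconn : G.Preconnected) (hbr : HasBranch G) (k : ℕ) :
    Finite (iterHL (pathGraph n) G k).1 ∧ AllPaths n (iterHL (pathGraph n) G k).2 ∧
      (iterHL (pathGraph n) G k).2.Preconnected ∧ HasBranch (iterHL (pathGraph n) G k).2 ∧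
      Nat.card (iterHL (pathGraph n) G k).1 + k ≤
        Nat.card (iterHL (pathGraph n) G k).2.edgeSet + Nat.card V := by
  induction k with
  | zero => exact ⟨‹_›, hG, hconn, hbr, Nat.le_add_left _ _⟩
  | succ k ih =>
    obtain ⟨hfin, hall, hc, hb, hcard⟩ := ih
    generalize hX : iterHL (pathGraph n) G k = X at *
    have hs : iterHL (pathGraph n) G (k + 1) = ⟨X.2.edgeSet, X.2.lineGraph⟩ := by
      rw [← hall.HL_eq (by omega), iterHL, hX]
    rw [hs]
    have := card_edgeSet_lineGraph hb
    refine ⟨?_, hall.lineGraph hc hb, preconnected_lineGraph hc, hall.hasBranch_lineGraph hn hb, ?_⟩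
    · exact Subtype.finite
    · dsimp only
      omega

/-- A finite connected graph with a vertex of degree at least three diverges under the `P_n`-line
graph operator if all its paths on three vertices extend to paths on `n` vertices. -/
theorem AllPaths.divergesByOrder {V : Type*} [Finite V] {G : SimpleGraph V} {n : ℕ}
    (hG : AllPaths n G) (hn : 4 ≤ n) (hconn : G.Preconnected) (hbr : HasBranch G) :
    DivergesByOrder (pathGraph n) G := by
  intro N _
  obtain ⟨-, -, -, -, h⟩ := hG.iterHL_invariant hn hconn hbr (N + Nat.card V)
  -- The summand `Nat.card V` offsets the initial deficit; one more iteration turns edges into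
  -- vertices.
  refine ⟨N + Nat.card V + 1, ?_⟩
  change N ≤ Nat.card (iterHL (pathGraph n) G (N + Nat.card V)).2.edgeSet
  omega

/-! ### The spider is good. -/

section spider

variable {x y z : ℕ}

theorem CL_adj_none_some {q : Σ i : Fin 3, Fin (![x, y, z] i)} :
    (CL x y z).Adj none (some q) ↔ (q.2 : ℕ) = 0 := by
  simp [CL]

theorem CL_adj_some_some {i j : Fin 3} {p : Fin (![x, y, z] i)} {q : Fin (![x, y, z] j)} :
    (CL x y z).Adj (some ⟨i, p⟩) (some ⟨j, q⟩) ↔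
      i = j ∧ ((p : ℕ) + 1 = q ∨ (q : ℕ) + 1 = p) := by
  simp only [CL, fromRel_adj]
  constructor
  · rintro ⟨-, ⟨h1, h2⟩ | ⟨h1, h2⟩⟩
    · exact ⟨h1, .inl h2⟩
    · exact ⟨h1.symm, .inr h2⟩
  · rintro ⟨rfl, h⟩
    refine ⟨?_, h.imp (fun h => ⟨rfl, h⟩) (fun h => ⟨rfl, h⟩)⟩
    rintro heq
    simp only [Option.some.injEq, Sigma.mk.injEq, heq_eq_eq, true_and] at heq
    subst heq
    omega

/-- The path of the spider that runs along leg `i` to the centre and then along leg `j`. -/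
def legPath (x y z : ℕ) (i j : Fin 3) (k : ℕ) : Option (Σ i : Fin 3, Fin (![x, y, z] i)) :=
  if h : k < ![x, y, z] i then some ⟨i, ⟨![x, y, z] i - 1 - k, by omega⟩⟩
  -- Truncated subtraction would send the centre's index to position 0 of leg `j`; the second
  -- condition excludes this.
  else if h' : k - ![x, y, z] i - 1 < ![x, y, z] j ∧ k ≠ ![x, y, z] i then
    some ⟨j, ⟨k - ![x, y, z] i - 1, h'.1⟩⟩
  else none

theorem legPath_left {i j : Fin 3} (p : Fin (![x, y, z] i)) {k : ℕ}
    (hk : k + p + 1 = ![x, y, z] i) : legPath x y z i j k = some ⟨i, p⟩ := by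
  have h : k < ![x, y, z] i := by omega
  rw [legPath, dif_pos h]
  congr 2
  exact Fin.ext (by dsimp only; omega)

theorem legPath_center {i j : Fin 3} : legPath x y z i j (![x, y, z] i) = none := by
  simp [legPath]

theorem legPath_right {i j : Fin 3} (p : Fin (![x, y, z] j)) {k : ℕ}
    (hk : k = ![x, y, z] i + p + 1) : legPath x y z i j k = some ⟨j, p⟩ := by
  have hp := p.2
  rw [legPath, dif_neg (by omega), dif_pos (by omega)]
  congr 2
  exact Fin.ext (by dsimp only; omega)

theorem legPath_cases {i j : Fin 3} {k : ℕ} (hk : k < ![x, y, z] i + ![x, y, z] j + 1) :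
    (∃ p : Fin (![x, y, z] i), k + p + 1 = ![x, y, z] i ∧ legPath x y z i j k = some ⟨i, p⟩) ∨
      (k = ![x, y, z] i ∧ legPath x y z i j k = none) ∨
      ∃ p : Fin (![x, y, z] j), k = ![x, y, z] i + p + 1 ∧ legPath x y z i j k = some ⟨j, p⟩ := by
  rcases lt_trichotomy k (![x, y, z] i) with h | h | h
  · have hp : k + (![x, y, z] i - 1 - k) + 1 = ![x, y, z] i := by omega
    exact .inl ⟨⟨![x, y, z] i - 1 - k, by omega⟩, hp, legPath_left _ hp⟩
  · exact .inr (.inl ⟨h, by rw [h, legPath_center]⟩)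
  · have hp : k = ![x, y, z] i + (k - ![x, y, z] i - 1) + 1 := by omega
    exact .inr (.inr ⟨⟨k - ![x, y, z] i - 1, by omega⟩, hp, legPath_right _ hp⟩)

theorem legPath_injOn {i j : Fin 3} (hij : i ≠ j) (k l : ℕ)
    (hk : k < ![x, y, z] i + ![x, y, z] j + 1) (hl : l < ![x, y, z] i + ![x, y, z] j + 1)
    (h : legPath x y z i j k = legPath x y z i j l) : k = l := by
  rcases legPath_cases hk with ⟨p, hp, hv⟩ | ⟨hp, hv⟩ | ⟨p, hp, hv⟩ <;>
  rcases legPath_cases hl with ⟨q, hq, hw⟩ | ⟨hq, hw⟩ | ⟨q, hq, hw⟩ <;>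
  rw [hv, hw] at h <;>
  simp only [Option.some.injEq, Sigma.mk.injEq, hij, hij.symm, false_and, heq_eq_eq,
    true_and, reduceCtorEq] at h
  · subst h; omega
  · omega
  · subst h; omega

theorem legPath_adj {i j : Fin 3} (k : ℕ) (hk : k + 1 < ![x, y, z] i + ![x, y, z] j + 1) :
    (CL x y z).Adj (legPath x y z i j k) (legPath x y z i j (k + 1)) := by
  rcases legPath_cases (Nat.lt_of_succ_lt hk) with ⟨p, hp, hv⟩ | ⟨hp, hv⟩ | ⟨p, hp, hv⟩ <;>
  rcases legPath_cases hk with ⟨q, hq, hw⟩ | ⟨hq, hw⟩ | ⟨q, hq, hw⟩ <;>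
  rw [hv, hw]
  · rw [CL_adj_some_some]
    exact ⟨rfl, by omega⟩
  · rw [adj_comm, CL_adj_none_some]
    dsimp only; omega
  · omega
  · omega
  · omega
  · rw [CL_adj_none_some]
    dsimp only; omega
  · omega
  · omega
  · rw [CL_adj_some_some]
    exact ⟨rfl, by omega⟩

theorem eq_legPath_of_adj {i j : Fin 3} {p : Fin (![x, y, z] j)}
    {u : Option (Σ i : Fin 3, Fin (![x, y, z] i))} (h : (CL x y z).Adj (some ⟨j, p⟩) u) :
    u = legPath x y z i j (![x, y, z] i + p) ∨
      (u = legPath x y z i j (![x, y, z] i + p + 2) ∧ (p : ℕ) + 1 < ![x, y, z] j) := by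
  rcases u with _ | ⟨l, q⟩
  · left
    rw [adj_comm, CL_adj_none_some] at h
    dsimp only at h
    rw [h, Nat.add_zero, legPath_center]
  · rw [CL_adj_some_some] at h
    obtain ⟨rfl, h | h⟩ := h
    · exact .inr ⟨(legPath_right q (by omega)).symm, by omega⟩
    · exact .inl (legPath_right q (by omega)).symm

theorem exists_eq_leg {i : Fin 3} {p : Fin (![x, y, z] i)}
    {P : List (Option (Σ i : Fin 3, Fin (![x, y, z] i)))}
    (hP : (some ⟨i, p⟩ :: P).IsChain (CL x y z).Adj) (hnone : none ∉ P) :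
    ∀ v ∈ some ⟨i, p⟩ :: P, ∃ q, v = some ⟨i, q⟩ := by
  induction P generalizing p with
  | nil => simp
  | cons u P ih =>
    rw [List.isChain_cons_cons] at hP
    rw [List.mem_cons, not_or] at hnone
    rcases u with _ | ⟨j, q⟩
    · exact absurd rfl hnone.1
    · obtain ⟨rfl, -⟩ := CL_adj_some_some.1 hP.1
      intro v hv
      rcases List.mem_cons.1 hv with rfl | hv
      · exact ⟨p, rfl⟩
      · exact ih hP.2 hnone.2 v hv

theorem length_le_leg {i : Fin 3} {l : List (Option (Σ i : Fin 3, Fin (![x, y, z] i)))}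
    (hl : ∀ v ∈ l, ∃ q, v = some ⟨i, q⟩) (hnd : l.Nodup) : l.length ≤ ![x, y, z] i := by
  classical
  have hs : l.toFinset ⊆ Finset.univ.image fun q : Fin (![x, y, z] i) =>
      (some ⟨i, q⟩ : Option (Σ i : Fin 3, Fin (![x, y, z] i))) := by
    intro v hv
    obtain ⟨q, rfl⟩ := hl v (List.mem_toFinset.1 hv)
    simp
  have := (Finset.card_le_card hs).trans Finset.card_image_le
  rwa [List.toFinset_card_of_nodup hnd, Finset.card_univ, Fintype.card_fin] at this

/-- Neither branch can revisit the centre, so each stays within one leg and is no longer than it. -/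
theorem ThroughPath.le_legs {n : ℕ} {i j : Fin 3} {p : Fin (![x, y, z] i)} {q : Fin (![x, y, z] j)}
    (h : ThroughPath n (CL x y z) (some ⟨i, p⟩) none (some ⟨j, q⟩)) :
    n ≤ ![x, y, z] i + ![x, y, z] j + 1 := by
  obtain ⟨P, Q, hP, hQ, hnd, hn⟩ := h
  rw [List.nodup_cons, List.nodup_append, List.mem_append, not_or] at hnd
  obtain ⟨⟨h1, h2⟩, ndP, ndQ, -⟩ := hnd
  have := length_le_leg (exists_eq_leg hP.tail fun h => h1 (List.mem_cons_of_mem _ h)) ndP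
  have := length_le_leg (exists_eq_leg hQ.tail fun h => h2 (List.mem_cons_of_mem _ h)) ndQ
  simp only [List.length_cons] at *
  omega

theorem preconnected_CL : (CL x y z).Preconnected := by
  have key : ∀ (i : Fin 3) (k : ℕ) (hk : k < ![x, y, z] i),
      (CL x y z).Reachable none (some ⟨i, ⟨k, hk⟩⟩) := by
    intro i k
    induction k with
    | zero => exact fun hk => (CL_adj_none_some.2 rfl : (CL x y z).Adj _ _).reachable
    | succ k ih =>
      intro hk
      refine (ih (Nat.lt_of_succ_lt hk)).trans (Adj.reachable ?_)
      exact CL_adj_some_some.2 ⟨rfl, .inl rfl⟩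
  have key' : ∀ u, (CL x y z).Reachable none u := by
    rintro (_ | ⟨i, ⟨k, hk⟩⟩)
    · exact .refl _
    · exact key i k hk
  exact fun u v => (key' u).symm.trans (key' v)

theorem eq_none_of_ncard_neighborSet {v : Option (Σ i : Fin 3, Fin (![x, y, z] i))}
    (hv : ((CL x y z).neighborSet v).ncard = 3) : v = none := by
  rcases v with _ | ⟨j, p⟩
  · rfl
  · have hs : (CL x y z).neighborSet (some ⟨j, p⟩) ⊆
        -- Here `legPath` with equal legs merely names the at most two neighbours of a leg vertex;
        -- no injectivity is needed.
        {legPath x y z j j (![x, y, z] j + p), legPath x y z j j (![x, y, z] j + p + 2)} :=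
      fun u hu => (eq_legPath_of_adj hu).imp id fun h => h.1
    have := (Set.ncard_le_ncard hs).trans (Set.ncard_insert_le _ _)
    rw [hv, Set.ncard_singleton] at this
    omega

theorem hasBranch_CL (hx : 1 ≤ x) (hy : 1 ≤ y) (hz : 1 ≤ z) : HasBranch (CL x y z) := by
  refine ⟨none, some ⟨0, ⟨0, hx⟩⟩, some ⟨1, ⟨0, hy⟩⟩, some ⟨2, ⟨0, hz⟩⟩, CL_adj_none_some.2 rfl,
    CL_adj_none_some.2 rfl, CL_adj_none_some.2 rfl, ?_, ?_, ?_⟩ <;>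
  exact fun h => absurd (congrArg Sigma.fst (Option.some.inj h)) (Fin.ne_of_val_ne (by norm_num))

theorem allPaths_CL {n : ℕ} (hpos : ∀ i, 0 < ![x, y, z] i)
    (hc : ∀ a b, (CL x y z).Adj none a → (CL x y z).Adj none b → a ≠ b →
      ThroughPath n (CL x y z) a none b) : AllPaths n (CL x y z) := by
  intro a b c hab hbc hac
  rcases b with _ | ⟨j, p⟩
  · exact hc a c hab.symm hbc hac
  -- Any other leg will do, since every two-leg path has at least `n` vertices.
  obtain ⟨i, hij⟩ := exists_ne j
  have hlen : n ≤ ![x, y, z] i + ![x, y, z] j + 1 := by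
    refine (hc (some ⟨i, ⟨0, hpos i⟩⟩) (some ⟨j, ⟨0, hpos j⟩⟩) (CL_adj_none_some.2 rfl)
      (CL_adj_none_some.2 rfl) ?_).le_legs
    simp [hij]
  have main : (p : ℕ) + 1 < ![x, y, z] j → ThroughPath n (CL x y z)
      (legPath x y z i j (![x, y, z] i + p)) (some ⟨j, p⟩)
      (legPath x y z i j (![x, y, z] i + p + 2)) := by
    intro hp
    rw [← legPath_right (i := i) p rfl]
    exact .of_fun _ (legPath_injOn hij) legPath_adj hlen (by omega)
  rcases eq_legPath_of_adj (i := i) hab.symm with ha | ⟨ha, hp⟩ <;>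
  rcases eq_legPath_of_adj (i := i) hbc with hc | ⟨hc, hp⟩
  · exact absurd (ha.trans hc.symm) hac
  · rw [ha, hc]
    exact main hp
  · rw [ha, hc]
    exact (main hp).symm
  · exact absurd (ha.trans hc.symm) hac

end spider

end HLine

theorem mainTheorem6 (n : ℕ) (hn : 4 ≤ n) (x y z : ℕ) (hx : 1 ≤ x) (hy : 1 ≤ y) (hz : 1 ≤ z)
    (v : Option (Σ i : Fin 3, Fin (![x, y, z] i)))
    (hv : ((HLine.CL x y z).neighborSet v).ncard = 3)
    (hadj : ∀ e f : (HLine.CL x y z).edgeSet,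
      v ∈ (e : Sym2 (Option (Σ i : Fin 3, Fin (![x, y, z] i)))) →
      v ∈ (f : Sym2 (Option (Σ i : Fin 3, Fin (![x, y, z] i)))) →
      e ≠ f → HLine.HAdjacent (SimpleGraph.pathGraph n) (HLine.CL x y z) e f) :
    HLine.DivergesByOrder (SimpleGraph.pathGraph n) (HLine.CL x y z) := by
  obtain rfl := HLine.eq_none_of_ncard_neighborSet hv
  have hpos : ∀ i, 0 < ![x, y, z] i := by
    intro i
    fin_cases i
    · exact hx
    · exact hy
    · exact hz
  refine (HLine.allPaths_CL hpos fun a b ha hb hab => ?_).divergesByOrder hn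
    HLine.preconnected_CL (HLine.hasBranch_CL hx hy hz)
  refine HLine.HAdjacent.throughPath ha.symm hb (hadj _ _ (by simp) (by simp) fun h => hab ?_)
  exact Sym2.congr_right.1 (Sym2.eq_swap.trans (congrArg Subtype.val h))
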